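/- Conventions. A deep ReLU net on $\mathbb R^d$ with $L\ge 1$ layers is a function $$x\mapsto a\cdot \sigma\circ\mathcal J_L\circ\sigma\circ\mathcal J_{L-1}\circ\dots\circ\sigma\circ\mathcal J_1(x),\qquad \mathcal J_\ell(x)=W_\ell x+b_\ell,$$ where $\sigma(t)=\max\{t,0\}$ acts coordinatewise, $W_\ell\in\mathbb R^{d_\ell\times d_{\ell-1}}$, $b_\ell\in\mathbb R^{d_\ell}$, $a\in\mathbb R^{d_L}$, $d_0=d$, and the widths $d_\ell\ge 1$ are arbitrary. Its structure prescribes which entries of the $W_\ell$, $b_\ell$ and $a$ are zero and, possibly, which of the other entries share a common value (weight sharing); its number of free parameters is the number of parameters that remain (without weight sharing, the number of entries not prescribed to be zero). For a Borel probability measure $\rho_X$ on a Borel set $\mathcal X\subseteq[-1,1]^d$ and $p\ge2$, the distortion $D_{\rho_X,p}\in[0,\infty]$ is the norm of the identity map $L^p(\mathcal X)\to L^2_{\rho_X}$, where $L^p(\mathcal X)$ is taken with respect to Lebesgue measure; it is $\infty$ if this map is not well defined or not bounded. Theorem. For every $d\ge1$ there is a constant $\tilde C>0$ depending only on $d$ such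 that the following holds. Let $0<\theta\le1$, let $\tilde L\in\mathbb N$ with $\tilde L>(2\theta)^{-1}$, let $g$ be any deep ReLU net on $\mathbb R^d$ with $L\ge1$ layers and $n$ free parameters satisfying $\|g\|_{L^\infty([-1,1]^d)}\le C^*$ for some $C^*>0$, let $\mathcal X\subseteq[-1,1]^d$ be a Borel set, and let $\rho_X$ be a Borel probability measure on $\mathcal X$ with $D_{\rho_X,p}<\infty$ for some $p\in[2,\infty)$. Let $m\ge1$ and let $(x_i,y_i)\in\mathbb R^d\times\mathbb R$, $i=1,\dots,m$, be data with $y_i=y_j$ whenever $x_i=x_j$ (for instance with pairwise distinct $x_i$). Then for every $\varepsilon>0$ there is a deep ReLU net $f$ on $\mathbb R^d$ with exactly $4\tilde L+16+\max\{L,2\}$ layers and at most $\tilde C\,\bigl(n+m(\tilde L+L)+\varepsilon^{-\theta}\bigr)$ free parameters, which is without weight sharing if $g$ is, such that $$f(x_i)=y_i\quad (i=1,\dots,m)\qquad\text{and}\qquad \|f-g\|_{L^2_{\rho_X}}\le\varepsilon .$$ -/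

import Mathlib

open MeasureTheory
open scoped ENNReal

noncomputable section

/-- The entries of a deep net with input dimension `d` and `L` layers, with values in `α`: for each
layer a weight matrix `W` and a bias vector `b` (the layer has positive width `e`), and finally the
outer vector `a`.  With `α = ℝ` these are the parameters of a deep net; with other `α` they
are used as labels of the parameter positions. -/
inductive NetEntries (α : Type) : ℕ → ℕ → Type
  | output {d : ℕ} (a : Fin d → α) : NetEntries α d 0
  | layer {d e L : ℕ} (he : 0 < e) (W : Matrix (Fin e) (Fin d) α) (b : Fin e → α)
      (N : NetEntries α e L) : NetEntries α d (L + 1)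

namespace NetEntries

/-- Apply a function to every entry. -/
def map {α β : Type} (φ : α → β) : {d L : ℕ} → NetEntries α d L → NetEntries β d L
  | _, _, output a => output (fun i => φ (a i))
  | _, _, layer he W b N => layer he (fun i j => φ (W i j)) (fun i => φ (b i)) (N.map φ)

/-- All entries, listed with multiplicity. -/
def toMultiset {α : Type} : {d L : ℕ} → NetEntries α d L → Multiset α
  | d, _, output a => (Finset.univ : Finset (Fin d)).val.map a
  | d, _, layer (e := e) _ W b N =>
      (Finset.univ : Finset (Fin e × Fin d)).val.map (fun ij => W ij.1 ij.2)
        + (Finset.univ : Finset (Fin e)).val.map b + N.toMultiset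

/-- The function `x ↦ a · σ(J_L(⋯ σ(J_1 x)))` with `J_ℓ x = W_ℓ x + b_ℓ` and
`σ(t) = max t 0` acting coordinatewise. -/
def eval : {d L : ℕ} → NetEntries ℝ d L → (Fin d → ℝ) → ℝ
  | _, _, output a, x => a ⬝ᵥ x
  | _, _, layer _ W b N, x => N.eval (fun i => max ((W.mulVec x + b) i) 0)

end NetEntries

/-- A deep ReLU net on `ℝ^d` with `L` layers and `n` free parameters.  The structure says of every
parameter position (weights, biases, outer coefficients) whether it is fixed to be zero (`none`) or
carries the `k`-th free parameter (`some k`); several positions may share one free parameter, as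
in convolutional nets.  `param` are the values of the free parameters. -/
structure DeepNet (d L n : ℕ) where
  pattern : NetEntries (Option (Fin n)) d L
  param : Fin n → ℝ

namespace DeepNet

/-- The actual weights, biases and outer coefficients. -/
def entries {d L n : ℕ} (g : DeepNet d L n) : NetEntries ℝ d L :=
  g.pattern.map (fun o => o.elim 0 g.param)

/-- The function realized by the net. -/
def eval {d L n : ℕ} (g : DeepNet d L n) : (Fin d → ℝ) → ℝ := g.entries.eval

/-- No weight sharing: every free parameter occupies at most one position (as in fully connected
and in sparsely connected nets). -/
def Unshared {d L n : ℕ} (g : DeepNet d L n) : Prop :=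
  ∀ k : Fin n, g.pattern.toMultiset.count (some k) ≤ 1

end DeepNet

/-- The cube `[-1,1]^d`. -/
def cube (d : ℕ) : Set (Fin d → ℝ) := Set.Icc (fun _ => -1) (fun _ => 1)

/-- The distortion of `ρ`: the norm of the identity map from `L^p(X)` (Lebesgue measure on `X`)
to `L²_ρ`, that is the smallest `K` with `‖f‖_{L²_ρ} ≤ K ‖f‖_{L^p(X)}` for all `f ∈ L^p(X)`;
it is `∞` if there is no such bound. (Applied to functions that vanish almost
everywhere, a bound also gives that the identity map is well defined on classes.) -/
def distortion {d : ℕ} (X : Set (Fin d → ℝ)) (ρ : Measure (Fin d → ℝ)) (p : ℝ) : ℝ≥0∞ :=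
  sInf {K : ℝ≥0∞ | ∀ f : (Fin d → ℝ) → ℝ, MemLp f (ENNReal.ofReal p) (volume.restrict X) →
    eLpNorm f 2 ρ ≤ K * eLpNorm f (ENNReal.ofReal p) (volume.restrict X)}

end

/-! A measure of finite distortion charges no Lebesgue null set, in particular not the finite set of
data points. So `g` can be corrected at the data at negligible cost in `L²_ρ`: add tent functions `c
* max (1 - K * ‖z - x i‖₁) 0` with total height `y i - g (x i)` at each data point. For large `K`
they do not interfere at the data, and their supports shrink to a `ρ`-null set
(`exists_bump_interpolation`). The rest is bookkeeping (`exists_deepNet_add_bumps`). A tent takes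
two layers and `O(d)` parameters. Nets of equal depth are added by placing them side by side, and
identity layers equalize depths. To pass through `σ`, the output of `g` is split into positive and
negative parts, which at most doubles its free parameters. Sharing inside `g` is kept; every
constant entry gets a parameter of its own, so no new sharing arises. -/

namespace NetEntries

/-! ### Relabelling and numbering entries -/

theorem map_map {α β γ : Type} (φ : α → β) (ψ : β → γ) {d L : ℕ} (N : NetEntries α d L) :
    (N.map φ).map ψ = N.map (ψ ∘ φ) := by
  induction N with
  | output a => rfl
  | layer he W b N ih => simp only [map, ih]; rfl

theorem map_congr {α β : Type} {φ ψ : α → β} {d L : ℕ} (N : NetEntries α d L)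
    (h : ∀ a ∈ N.toMultiset, φ a = ψ a) : N.map φ = N.map ψ := by
  induction N with
  | output a =>
    simp only [map]
    congr 1
    funext i
    exact h _ (by simp [toMultiset])
  | layer he W b N ih =>
    simp only [map]
    congr 1
    · funext i j
      exact h _ (Multiset.mem_add.2 (.inl (Multiset.mem_add.2 (.inl
        (Multiset.mem_map.2 ⟨(i, j), Finset.mem_univ (i, j), rfl⟩)))))
    · funext i
      exact h _ (Multiset.mem_add.2 (.inl (Multiset.mem_add.2 (.inr
        (Multiset.mem_map.2 ⟨i, Finset.mem_univ i, rfl⟩)))))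
    · exact ih fun a ha => h a (Multiset.mem_add.2 (.inr ha))

theorem toMultiset_map {α β : Type} (φ : α → β) {d L : ℕ} (N : NetEntries α d L) :
    (N.map φ).toMultiset = N.toMultiset.map φ := by
  induction N with
  | output a => simp only [map, toMultiset, Multiset.map_map, Function.comp_def]
  | layer he W b N ih =>
    simp only [map, toMultiset, ih, Multiset.map_add, Multiset.map_map, Function.comp_def]

/-- The entries of a net can be numbered injectively. -/
theorem exists_numbering {α : Type} {d L : ℕ} (N : NetEntries α d L) :
    ∃ M : NetEntries (α × ℕ) d L,
      M.map Prod.fst = N ∧ (M.toMultiset.map Prod.snd).Nodup := by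
  induction N with
  | output a =>
    refine ⟨output fun i => (a i, i), rfl, ?_⟩
    simp only [toMultiset, Multiset.map_map]
    exact (Multiset.nodup_map_iff_of_injective Fin.val_injective).2 Finset.univ.nodup
  | layer he W b N ih =>
    obtain ⟨M, hM, hnd⟩ := ih
    -- The residues mod 3 keep apart the numbers of weights, biases and later layers.
    refine ⟨layer he (fun i j => (W i j, 3 * Nat.pair i j)) (fun i => (b i, 3 * (i : ℕ) + 1))
      (M.map fun q => (q.1, 3 * q.2 + 2)), ?_, ?_⟩
    · simp only [map, map_map]
      congr 1
    · simp only [toMultiset, toMultiset_map, Multiset.map_add, Multiset.map_map, Function.comp_def]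
      rw [Multiset.nodup_add, Multiset.nodup_add]
      refine ⟨⟨?_, ?_, ?_⟩, ?_, ?_⟩
      · refine (Multiset.nodup_map_iff_of_injective ?_).2 Finset.univ.nodup
        rintro ⟨i, j⟩ ⟨i', j'⟩ h
        have h1 := Nat.pair_eq_pair.1 (Nat.eq_of_mul_eq_mul_left (by norm_num) h)
        exact Prod.ext (Fin.ext h1.1) (Fin.ext h1.2)
      · refine (Multiset.nodup_map_iff_of_injective ?_).2 Finset.univ.nodup
        intro i j h
        exact Fin.ext (by simpa using h)
      · rw [Multiset.disjoint_left]
        simp only [Multiset.mem_map]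
        rintro _ ⟨a, -, rfl⟩ ⟨c, -, h⟩
        omega
      · have := (Multiset.nodup_map_iff_of_injective (f := fun k : ℕ => 3 * k + 2)
          (fun a c h => by simpa using h)).2 hnd
        simpa [Multiset.map_map, Function.comp_def] using this
      · rw [Multiset.disjoint_left]
        simp only [Multiset.mem_map, Multiset.mem_add]
        rintro _ (⟨a, -, rfl⟩ | ⟨a, -, rfl⟩) ⟨c, -, h⟩ <;> omega

/-! ### Free labels and sums of nets -/

section Labels

variable {β : Type}

/-- The free labels of a pattern, listed with multiplicity. -/
def labels {d L : ℕ} (N : NetEntries (Option β) d L) : Multiset β :=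
  (N.toMultiset.map fun o => o.elim 0 fun k => {k}).sum

theorem labels_output {d : ℕ} (a : Fin d → Option β) :
    (output a).labels = ∑ i, (a i).elim 0 fun k => {k} := by
  simp only [labels, toMultiset, Multiset.map_map]
  rfl

theorem labels_layer {d e L : ℕ} (he : 0 < e) (W : Matrix (Fin e) (Fin d) (Option β))
    (b : Fin e → Option β) (N : NetEntries (Option β) e L) :
    (layer he W b N).labels = ∑ i, ∑ j, (W i j).elim 0 (fun k => {k})
      + ∑ i, (b i).elim 0 (fun k => {k}) + N.labels := by
  rw [← Fintype.sum_prod_type']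
  simp only [labels, toMultiset, Multiset.map_add, Multiset.sum_add, Multiset.map_map]
  rfl

/-- Links `Unshared`, a condition on entries, to `labels`, which is additive under `stack`. -/
theorem count_labels [DecidableEq β] {d L : ℕ} (N : NetEntries (Option β) d L) (k : β) :
    N.labels.count k = N.toMultiset.count (some k) := by
  unfold labels
  induction N.toMultiset using Multiset.induction_on with
  | empty => simp
  | cons o s ih =>
    rw [Multiset.map_cons, Multiset.sum_cons, Multiset.count_add, ih, Multiset.count_cons]
    cases o with
    | none => simp
    | some l => simp [Multiset.count_singleton, add_comm]

/-- The function realized by a pattern with label values `v`. -/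
def evalWith (v : β → ℝ) {d L : ℕ} (N : NetEntries (Option β) d L) : (Fin d → ℝ) → ℝ :=
  (N.map fun o => o.elim 0 v).eval

theorem evalWith_output (v : β → ℝ) {d : ℕ} (a : Fin d → Option β) (x : Fin d → ℝ) :
    (output a).evalWith v x = ∑ i, (a i).elim 0 v * x i := rfl

theorem evalWith_layer (v : β → ℝ) {d e L : ℕ} (he : 0 < e)
    (W : Matrix (Fin e) (Fin d) (Option β)) (b : Fin e → Option β)
    (N : NetEntries (Option β) e L) (x : Fin d → ℝ) :
    (layer he W b N).evalWith v x = N.evalWith v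
      (fun i => max (∑ j, (W i j).elim 0 v * x j + (b i).elim 0 v) 0) := rfl

/-- Two nets side by side, acting on separate inputs. -/
def dirSum : {d d' L : ℕ} → NetEntries (Option β) d L → NetEntries (Option β) d' L →
    NetEntries (Option β) (d + d') L
  | _, _, _, output a, output a' => output (Fin.addCases a a')
  | _, _, _, layer he W b N, layer _ W' b' N' =>
      layer (Nat.add_pos_left he _)
        (.of fun i j => Fin.addCases
          (fun i => Fin.addCases (fun j => W i j) (fun _ => none) j)
          (fun i => Fin.addCases (fun _ => none) (fun j => W' i j) j) i)
        (Fin.addCases b b') (N.dirSum N')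

/-- Two nets side by side, acting on the same input. -/
def stack {d L : ℕ} : NetEntries (Option β) d (L + 1) → NetEntries (Option β) d (L + 1) →
    NetEntries (Option β) d (L + 1)
  | layer he W b N, layer _ W' b' N' =>
      layer (Nat.add_pos_left he _) (.of fun i j => Fin.addCases (fun i => W i j) (fun i => W' i j) i)
        (Fin.addCases b b') (N.dirSum N')

theorem labels_dirSum {d L : ℕ} (N : NetEntries (Option β) d L) :
    ∀ {d' : ℕ} (N' : NetEntries (Option β) d' L), (N.dirSum N').labels = N.labels + N'.labels := by
  induction N with
  | output a =>
    rintro d' ⟨a'⟩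
    simp [dirSum, labels_output, Fin.sum_univ_add]
  | layer he W b N ih =>
    intro d' N'
    cases N' with
    | layer he' W' b' N' =>
      simp only [dirSum, labels_layer, Fin.sum_univ_add, ih, Matrix.of_apply, Fin.addCases_left,
        Fin.addCases_right, Option.elim_none, Finset.sum_const_zero, add_zero, zero_add]
      abel

theorem evalWith_dirSum (v : β → ℝ) {d L : ℕ} (N : NetEntries (Option β) d L) :
    ∀ {d' : ℕ} (N' : NetEntries (Option β) d' L) (x : Fin d → ℝ) (x' : Fin d' → ℝ),
      (N.dirSum N').evalWith v (Fin.addCases x x') = N.evalWith v x + N'.evalWith v x' := by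
  induction N with
  | output a =>
    rintro d' ⟨a'⟩ x x'
    simp [dirSum, evalWith_output, Fin.sum_univ_add]
  | layer he W b N ih =>
    intro d' N' x x'
    cases N' with
    | layer he' W' b' N' =>
      simp only [dirSum, evalWith_layer, ← ih]
      refine congrArg _ (funext fun i => ?_)
      induction i using Fin.addCases <;> simp [Fin.sum_univ_add]

theorem labels_stack {d L : ℕ} (N N' : NetEntries (Option β) d (L + 1)) :
    (N.stack N').labels = N.labels + N'.labels := by
  cases N with
  | layer he W b N =>
    cases N' with
    | layer he' W' b' N' =>
      simp only [stack, labels_layer, Fin.sum_univ_add, labels_dirSum, Matrix.of_apply, Fin.addCases_left,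
        Fin.addCases_right]
      abel

theorem evalWith_stack (v : β → ℝ) {d L : ℕ} (N N' : NetEntries (Option β) d (L + 1))
    (x : Fin d → ℝ) : (N.stack N').evalWith v x = N.evalWith v x + N'.evalWith v x := by
  cases N with
  | layer he W b N =>
    cases N' with
    | layer he' W' b' N' =>
      simp only [stack, evalWith_layer, ← evalWith_dirSum]
      refine congrArg _ (funext fun i => ?_)
      induction i using Fin.addCases <;> simp

/-- Finitely many nets can be added to a net. -/
theorem exists_add_sum {ι : Type} (v : β → ℝ) {d L : ℕ} (N : NetEntries (Option β) d (L + 1))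
    (F : ι → NetEntries (Option β) d (L + 1)) (s : Finset ι) :
    ∃ M : NetEntries (Option β) d (L + 1),
      (∀ x, M.evalWith v x = N.evalWith v x + ∑ i ∈ s, (F i).evalWith v x) ∧
      M.labels = N.labels + ∑ i ∈ s, (F i).labels := by
  classical
  induction s using Finset.induction_on with
  | empty => exact ⟨N, by simp, by simp⟩
  | insert i s hi ih =>
    obtain ⟨M, hM, hl⟩ := ih
    refine ⟨M.stack (F i), fun x => ?_, ?_⟩
    · rw [evalWith_stack, hM, Finset.sum_insert hi]; ring
    · rw [labels_stack, hl, Finset.sum_insert hi]; abel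

end Labels

/-! ### Deepening a net, tents, conversion to `DeepNet` -/

section Constants

variable {κ : Type}

/-- A net of identity layers, with free entries `1`, followed by the outer vector `c`. -/
def carry {e : ℕ} (he : 0 < e) (c : Fin e → ℝ) : (k : ℕ) → NetEntries (Option (κ ⊕ ℝ)) e k
  | 0 => output fun i => some (.inr (c i))
  | k + 1 => layer he (.of fun i j => if i = j then some (.inr 1) else none) (fun _ => none)
      (carry he c k)

theorem evalWith_carry (v : κ → ℝ) {e : ℕ} (he : 0 < e) (c : Fin e → ℝ) (k : ℕ)
    (x : Fin e → ℝ) (hx : ∀ i, 0 ≤ x i) :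
    (carry he c k).evalWith (Sum.elim v id) x = ∑ i, c i * x i := by
  induction k with
  | zero => simp [carry, evalWith_output]
  | succ k ih =>
    rw [carry, evalWith_layer, ← ih]
    congr 1
    funext i
    simp [apply_ite (fun o : Option (κ ⊕ ℝ) => o.elim 0 (Sum.elim v id)), hx]

theorem labels_carry {e : ℕ} (he : 0 < e) (c : Fin e → ℝ) (k : ℕ) :
    (carry (κ := κ) he c k).labels.card = e * (k + 1) ∧
      ∀ l, Sum.inl l ∉ (carry (κ := κ) he c k).labels := by
  induction k with
  | zero => simp [carry, labels_output, Multiset.mem_sum]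
  | succ k ih =>
    rw [carry, labels_layer]
    refine ⟨?_, fun l => ?_⟩
    · simp [apply_ite (fun o : Option (κ ⊕ ℝ) =>
        o.elim (0 : Multiset (κ ⊕ ℝ)) (fun k => {k})), ih.1]
      ring
    · simp [apply_ite (fun o : Option (κ ⊕ ℝ) =>
        o.elim (0 : Multiset (κ ⊕ ℝ)) (fun k => {k})), ih.2]

/-- A net extended in depth: its value and the negative of its value become two neurons, which are
carried through the remaining layers.  The label `(l, false)` takes the negative of the value of
`(l, true)`. -/
def extend (k : ℕ) : {d L : ℕ} → NetEntries (Option κ) d L →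
    NetEntries (Option (κ × Bool ⊕ ℝ)) d (k + 1 + L)
  | _, _, output a => layer two_pos (.of fun i j => (a j).map fun l => .inl (l, i = 0))
      (fun _ => none) (carry two_pos ![1, -1] k)
  | _, _, layer he W b N => layer he (.of fun i j => (W i j).map fun l => .inl (l, true))
      (fun i => (b i).map fun l => .inl (l, true)) (extend k N)

/-- Rests on `t = max t 0 - max (-t) 0`; both parts are nonnegative, so identity layers preserve
them. -/
theorem evalWith_extend (v : κ → ℝ) (k : ℕ) {d L : ℕ} (N : NetEntries (Option κ) d L)
    (x : Fin d → ℝ) :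
    (N.extend k).evalWith (Sum.elim (fun q => bif q.2 then v q.1 else -v q.1) id) x =
      N.evalWith v x := by
  induction N with
  | output a =>
    have h1 (j) : ((a j).map fun l => (Sum.inl (l, true) : κ × Bool ⊕ ℝ)).elim 0
        (Sum.elim (fun q => bif q.2 then v q.1 else -v q.1) id) = (a j).elim 0 v := by
      cases a j <;> rfl
    have h2 (j) : ((a j).map fun l => (Sum.inl (l, false) : κ × Bool ⊕ ℝ)).elim 0
        (Sum.elim (fun q => bif q.2 then v q.1 else -v q.1) id) = -(a j).elim 0 v := by
      cases a j <;> simp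
    rw [extend, evalWith_layer, evalWith_carry _ _ _ _ _ fun i => le_max_right _ _,
      evalWith_output]
    simp only [Fin.sum_univ_two, Fin.isValue, decide_true, one_ne_zero, decide_false, Matrix.of_apply, h1, h2,
      Matrix.cons_val_zero, Matrix.cons_val_one, Option.elim_none, neg_mul, Finset.sum_neg_distrib,
      add_zero, one_mul]
    generalize ∑ i, (a i).elim 0 v * x i = t
    rcases le_total t 0 with h | h
    · rw [max_eq_right h, max_eq_left (neg_nonneg.2 h)]; ring
    · rw [max_eq_left h, max_eq_right (neg_nonpos.2 h)]; ring
  | layer he W b N ih =>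
    have h (o : Option κ) : (o.map fun l => (Sum.inl (l, true) : κ × Bool ⊕ ℝ)).elim 0
        (Sum.elim (fun q => bif q.2 then v q.1 else -v q.1) id) = o.elim 0 v := by
      cases o <;> rfl
    simp only [extend, Nat.add_eq, evalWith_layer, Matrix.of_apply, h, ih]

/-- Only the outer vector is duplicated, and its two copies carry different Booleans; hence no
multiplicity grows. -/
theorem count_labels_extend [DecidableEq κ] [DecidableEq (κ × Bool ⊕ ℝ)] (k : ℕ) {d L : ℕ}
    (N : NetEntries (Option κ) d L) (q : κ × Bool) :
    (N.extend k).labels.count (.inl q) ≤ N.labels.count q.1 := by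
  have h (o : Option κ) (c : Bool) : Multiset.count (Sum.inl q)
      ((o.map fun l => (Sum.inl (l, c) : κ × Bool ⊕ ℝ)).elim 0 fun k => {k}) =
        if c = q.2 then (o.elim 0 fun k => {k} : Multiset κ).count q.1 else 0 := by
    obtain ⟨l, c'⟩ := q
    cases o <;> by_cases hc : c = c' <;> simp [Multiset.count_singleton, hc, eq_comm]
  induction N with
  | output a =>
    rw [extend, labels_layer, labels_output]
    simp only [Fin.sum_univ_two, Matrix.of_apply, Multiset.count_add, Multiset.count_sum', h,
      Multiset.count_eq_zero_of_notMem ((labels_carry _ _ _).2 _)]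
    obtain ⟨l, _ | _⟩ := q <;> simp
  | layer he W b N ih =>
    simp only [extend, Nat.add_eq, labels_layer, Matrix.of_apply, Multiset.count_add,
      Multiset.count_sum', h]
    refine add_le_add (add_le_add ?_ ?_) ih
    · exact Finset.sum_le_sum fun i _ => Finset.sum_le_sum fun j _ => by split_ifs <;> simp
    · exact Finset.sum_le_sum fun i _ => by split_ifs <;> simp

theorem countP_sum {α ι : Type} (p : α → Prop) [DecidablePred p] (s : Finset ι)
    (F : ι → Multiset α) : (∑ i ∈ s, F i).countP p = ∑ i ∈ s, (F i).countP p :=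
  map_sum (Multiset.countPAddMonoidHom p) F s

theorem countP_labels_extend (k : ℕ) {d L : ℕ} (N : NetEntries (Option κ) d L) :
    (N.extend k).labels.countP (·.isRight) = 2 * (k + 1) := by
  have h (o : Option κ) (c : Bool) : Multiset.countP (·.isRight = true)
      ((o.map fun l => (Sum.inl (l, c) : κ × Bool ⊕ ℝ)).elim 0 fun k => {k}) = 0 := by
    cases o <;> simp [← Multiset.cons_zero]
  induction N with
  | output a =>
    have h' : (carry (κ := κ × Bool) two_pos ![1, -1] k).labels.countP (·.isRight) =
        2 * (k + 1) := by
      rw [← (labels_carry (κ := κ × Bool) two_pos ![1, -1] k).1, Multiset.countP_eq_card]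
      rintro (l | r) hl
      · exact absurd hl ((labels_carry _ _ _).2 _)
      · rfl
    simp only [extend, labels_layer, Multiset.countP_add, h', Matrix.of_apply, countP_sum, h]
    simp
  | layer he W b N ih =>
    simp only [extend, Nat.add_eq, labels_layer, Multiset.countP_add, ih, Matrix.of_apply,
      countP_sum, h]
    simp

/-- A net for the function `z ↦ c * max (1 - K * ∑ a, |z a - x a|) 0`, supported near `x`. -/
def bump {d : ℕ} (hd : 0 < d) (K c : ℝ) (x : Fin d → ℝ) (k : ℕ) :
    NetEntries (Option (κ ⊕ ℝ)) d (k + 1 + 1) :=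
  layer (Nat.add_pos_left hd d)
    (.of fun i j => Fin.addCases (fun a => if a = j then some (.inr K) else none)
      (fun a => if a = j then some (.inr (-K)) else none) i)
    (Fin.addCases (fun a => some (.inr (-(K * x a)))) (fun a => some (.inr (K * x a))))
    (layer one_pos (.of fun _ _ => some (.inr (-1))) (fun _ => some (.inr 1))
      (carry one_pos (fun _ => c) k))

/-- The first layer yields `|t|` as `max t 0 + max (-t) 0` in each coordinate; the second truncates.
-/
theorem evalWith_bump (v : κ → ℝ) {d : ℕ} (hd : 0 < d) {K : ℝ} (hK : 0 ≤ K) (c : ℝ)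
    (x : Fin d → ℝ) (k : ℕ) (z : Fin d → ℝ) :
    (bump hd K c x k).evalWith (Sum.elim v id) z = c * max (1 - K * ∑ a, |z a - x a|) 0 := by
  rw [bump, evalWith_layer, evalWith_layer, evalWith_carry _ _ _ _ _ fun i => le_max_right _ _]
  have h (a : Fin d) : max (K * z a + -(K * x a)) 0 + max (-(K * z a) + K * x a) 0 =
      K * |z a - x a| := by
    rw [← abs_of_nonneg hK, ← abs_mul, abs_of_nonneg hK]
    rcases le_total 0 (K * (z a - x a)) with h | h
    · rw [abs_of_nonneg h, max_eq_left (by linarith), max_eq_right (by linarith)]; ring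
    · rw [abs_of_nonpos h, max_eq_right (by linarith), max_eq_left (by linarith)]; ring
  simp only [Fin.sum_univ_add, Fin.addCases_left, Fin.addCases_right, Matrix.of_apply,
    apply_ite (fun o : Option (κ ⊕ ℝ) => o.elim 0 (Sum.elim v id)), Option.elim_some,
    Option.elim_none, Sum.elim_inr, id_eq, ite_mul, zero_mul, Finset.sum_ite_eq, Finset.mem_univ,
    if_true, neg_mul, one_mul, Finset.sum_neg_distrib, Finset.univ_unique, Finset.sum_singleton,
    Finset.mul_sum, ← h, Finset.sum_add_distrib]
  congr 2
  ring

theorem labels_bump {d : ℕ} (hd : 0 < d) (K c : ℝ) (x : Fin d → ℝ) (k : ℕ) :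
    (bump (κ := κ) hd K c x k).labels.card = 6 * d + k + 2 ∧
      ∀ l, Sum.inl l ∉ (bump (κ := κ) hd K c x k).labels := by
  rw [bump, labels_layer, labels_layer]
  refine ⟨?_, fun l => ?_⟩
  · simp only [Fin.sum_univ_add, Fin.addCases_left, Fin.addCases_right, Matrix.of_apply,
      apply_ite (fun o : Option (κ ⊕ ℝ) => o.elim (0 : Multiset (κ ⊕ ℝ)) (fun k => {k})),
      Option.elim_some, Option.elim_none, Finset.sum_ite_eq, Finset.mem_univ, if_true,
      Multiset.card_add, Multiset.card_sum, Multiset.card_singleton, (labels_carry _ _ _).1]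
    simp
    ring
  · simp only [Fin.sum_univ_add, Fin.addCases_left, Fin.addCases_right, Matrix.of_apply,
      apply_ite (fun o : Option (κ ⊕ ℝ) => o.elim (0 : Multiset (κ ⊕ ℝ)) (fun k => {k})),
      Option.elim_some, Option.elim_none, Finset.sum_ite_eq, Finset.mem_univ, if_true,
      Multiset.mem_add, Multiset.mem_sum, Multiset.mem_singleton, (labels_carry _ _ _).2]
    simp

/-- If every constant entry gets a free parameter of its own, a net with shared labels and constant
entries becomes a `DeepNet`. -/
theorem exists_deepNet [Fintype κ] [DecidableEq (κ ⊕ ℝ)] (v : κ → ℝ) {d L : ℕ}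
    (M : NetEntries (Option (κ ⊕ ℝ)) d L) :
    ∃ N ≤ Fintype.card κ + M.labels.countP (·.isRight), ∃ f : DeepNet d L N,
      f.eval = M.evalWith (Sum.elim v id) ∧
      ((∀ k, M.labels.count (.inl k) ≤ 1) → f.Unshared) := by
  classical
  obtain ⟨P, hPM, hnd⟩ := M.exists_numbering
  let const : Option (κ ⊕ ℝ) × ℕ → Option (ℝ × ℕ) :=
    fun q => q.1.elim none (Sum.elim (fun _ => none) fun r => some (r, q.2))
  -- Constant entries paired with their position numbers: equal values at different positions stay
  -- different parameters.
  let T : Finset (ℝ × ℕ) := (P.toMultiset.filterMap const).toFinset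
  have hT : T.card ≤ M.labels.countP (·.isRight) := by
    refine (Multiset.toFinset_card_le _).trans ?_
    rw [labels, ← hPM, toMultiset_map]
    induction P.toMultiset using Multiset.induction_on with
    | empty => simp
    | cons q s ih =>
      obtain ⟨_ | _ | r, j⟩ := q
      · simpa [Multiset.filterMap_cons, const] using ih
      · simpa [Multiset.filterMap_cons, const, Multiset.countP_add, ← Multiset.cons_zero] using ih
      · simp only [const, Multiset.filterMap_cons, Multiset.map_cons, Multiset.sum_cons,
          Multiset.countP_add, Option.elim_some, Sum.elim_inr, Multiset.card_add] at ih ⊢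
        exact add_le_add (Multiset.countP_pos.2 ⟨_, Multiset.mem_singleton_self _, rfl⟩) ih
  -- The fallback `none` never occurs on entries of `P`, by definition of `T`.
  let relabel : Option (κ ⊕ ℝ) × ℕ → Option (κ ⊕ T) := fun q =>
    q.1.elim none (Sum.elim (fun k => some (.inl k))
      fun r => if h : (r, q.2) ∈ T then some (.inr ⟨_, h⟩) else none)
  let e : Fin (Fintype.card (κ ⊕ T)) ≃ κ ⊕ T := (Fintype.equivFin _).symm
  refine ⟨Fintype.card (κ ⊕ T), by simpa using hT, ⟨P.map fun q => (relabel q).map e.symm,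
    fun i => Sum.elim v (fun t => t.1.1) (e i)⟩, ?_, fun h i => ?_⟩
  · rw [evalWith, ← hPM, map_map]
    simp only [DeepNet.eval, DeepNet.entries, map_map]
    congr 1
    refine map_congr _ ?_
    rintro ⟨_ | _ | r, j⟩ hq
    · rfl
    · simp [relabel]
    · have : (r, j) ∈ T := Multiset.mem_toFinset.2 ((Multiset.mem_filterMap const P.toMultiset).2 ⟨_, hq, rfl⟩)
      simp [relabel, this]
  · have hi (q) : some i = (relabel q).map e.symm ↔ relabel q = some (e i) := by
      rw [eq_comm, Option.map_eq_some_iff]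
      simp [Equiv.symm_apply_eq]
    simp only [toMultiset_map, Multiset.count_map, hi]
    rcases e i with k | t
    · refine le_trans ?_ (h k)
      rw [count_labels, ← hPM, toMultiset_map, Multiset.count_map]
      refine Multiset.card_le_card (Multiset.monotone_filter_right _ ?_)
      rintro ⟨_ | _ | r, j⟩ hq
      · simp [relabel] at hq
      · simpa [relabel, eq_comm] using hq
      · simp [relabel] at hq
    · refine le_trans ?_ (Multiset.nodup_iff_count_le_one.1 hnd.of_map (some (.inr t.1.1), t.1.2))
      rw [Multiset.count, Multiset.countP_eq_card_filter]
      refine Multiset.card_le_card (Multiset.monotone_filter_right _ ?_)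
      rintro ⟨_ | _ | r, j⟩ hq
      · simp [relabel] at hq
      · simp [relabel] at hq
      · simp only [relabel, Option.elim_some, Sum.elim_inr, Option.dite_none_right_eq_some,
          Option.some.injEq, Sum.inr.injEq] at hq
        obtain ⟨_, rfl⟩ := hq
        rfl

end Constants

end NetEntries

/-! ### Small corrections in `L²_ρ` -/

/-- A measure of finite distortion does not charge Lebesgue null sets. -/
theorem measure_eq_zero_of_distortion_lt_top {d : ℕ} {X : Set (Fin d → ℝ)}
    {ρ : Measure (Fin d → ℝ)} {p : ℝ} (h : distortion X ρ p < ∞) {S : Set (Fin d → ℝ)}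
    (hS : MeasurableSet S) (h0 : volume S = 0) : ρ S = 0 := by
  obtain ⟨K, hK, -⟩ := sInf_lt_iff.1 h
  -- The indicator of `S` has `L^p` norm zero, so the distortion bound makes its `L²_ρ` norm vanish.
  have h1 : S.indicator (fun _ => (1 : ℝ)) =ᵐ[volume.restrict X] 0 := by
    refine indicator_meas_zero (le_antisymm ?_ zero_le)
    exact (Measure.restrict_apply_le _ _).trans h0.le
  have h2 := hK (S.indicator fun _ => 1) ((memLp_congr_ae h1).2 MemLp.zero)
  rw [eLpNorm_congr_ae h1, eLpNorm_zero, mul_zero, nonpos_iff_eq_zero,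
    eLpNorm_indicator_const hS two_ne_zero (by simp)] at h2
  simpa [not_lt_of_ge] using h2

/-- A combination of bumps of small support: it interpolates, and its norm is small. -/
theorem exists_bump_interpolation {d : ℕ} {ρ : Measure (Fin d → ℝ)}
    [IsFiniteMeasure ρ] {m : ℕ} (x : Fin m → Fin d → ℝ) (hρ : ρ (Set.range x) = 0)
    (t : Fin m → ℝ) (ht : ∀ i j, x i = x j → t i = t j) {ε : ℝ} (hε : 0 < ε) :
    ∃ (K : ℝ) (c : Fin m → ℝ), 0 < K ∧
      (∀ i, ∑ j, c j * max (1 - K * ∑ a, |x i a - x j a|) 0 = t i) ∧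
      eLpNorm (fun z => ∑ j, c j * max (1 - K * ∑ a, |z a - x j a|) 0) 2 ρ ≤
        ENNReal.ofReal ε := by
  classical
  -- Tents at a repeated data point add up, hence the division by its multiplicity.
  set c : Fin m → ℝ := fun i => t i / (Finset.univ.filter fun j => x i = x j).card with hc
  have hsep : ∀ᶠ K : ℝ in Filter.atTop, ∀ i j, x i ≠ x j → 1 ≤ K * ∑ a, |x i a - x j a| := by
    refine Filter.eventually_all.2 fun i => Filter.eventually_all.2 fun j => ?_
    by_cases hij : x i = x j
    · exact .of_forall fun K h => absurd hij h
    · have hpos : 0 < ∑ a, |x i a - x j a| := by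
        obtain ⟨a, ha⟩ := Function.ne_iff.1 hij
        exact Finset.sum_pos' (fun _ _ => abs_nonneg _)
          ⟨a, Finset.mem_univ a, abs_pos.2 (sub_ne_zero.2 ha)⟩
      filter_upwards [Filter.eventually_ge_atTop (1 / ∑ a, |x i a - x j a|)] with K hK _
      exact (div_le_iff₀ hpos).1 hK
  -- The tents live in the `K⁻¹`-neighbourhood of a closed null set; its measure tends to zero by
  -- continuity from above.
  have hsmall : ∀ᶠ K : ℝ in Filter.atTop, ENNReal.ofReal (∑ j, |c j|) *
      ρ (Metric.cthickening K⁻¹ (Set.range x)) ^ (1 / 2 : ℝ) < ENNReal.ofReal ε := by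
    have h1 : Filter.Tendsto (fun r => ρ (Metric.cthickening r (Set.range x))) (nhds 0)
        (nhds 0) := by
      rw [← hρ]
      exact tendsto_measure_cthickening_of_isClosed ⟨1, one_pos, measure_ne_top _ _⟩
        (Set.finite_range x).isClosed
    have h2 := ENNReal.Tendsto.const_mul (a := ENNReal.ofReal (∑ j, |c j|))
      (((ENNReal.continuous_rpow_const (y := (1 / 2 : ℝ))).tendsto 0).comp
        (h1.comp tendsto_inv_atTop_zero)) (.inr ENNReal.ofReal_ne_top)
    rw [ENNReal.zero_rpow_of_pos (by norm_num), mul_zero] at h2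
    exact h2.eventually (gt_mem_nhds (ENNReal.ofReal_pos.2 hε))
  obtain ⟨K, hK0, hKsep, hKsmall⟩ :=
    ((Filter.eventually_gt_atTop (0 : ℝ)).and (hsep.and hsmall)).exists
  refine ⟨K, c, hK0, fun i => ?_, le_trans ?_ hKsmall.le⟩
  · have h (j) : c j * max (1 - K * ∑ a, |x i a - x j a|) 0 = if x i = x j then c i else 0 := by
      split_ifs with hij
      · simp [hc, hij, ht i j hij]
      · rw [max_eq_right (by linarith [hKsep i j hij]), mul_zero]
    rw [Finset.sum_congr rfl fun j _ => h j, ← Finset.sum_filter, Finset.sum_const, nsmul_eq_mul]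
    refine mul_div_cancel₀ _ (Nat.cast_ne_zero.2 (Finset.card_ne_zero_of_mem (a := i) ?_))
    simp
  · set U := Metric.cthickening K⁻¹ (Set.range x)
    have hU : MeasurableSet U := Metric.isClosed_cthickening.measurableSet
    have hA : 0 ≤ ∑ j, |c j| := Finset.sum_nonneg fun _ _ => abs_nonneg _
    have h2 := eLpNorm_indicator_const (μ := ρ) (c := ∑ j, |c j|) hU two_ne_zero
      ENNReal.ofNat_ne_top
    rw [Real.enorm_of_nonneg hA, ENNReal.toReal_ofNat] at h2
    rw [← h2]
    refine eLpNorm_mono_real fun z => ?_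
    by_cases hz : z ∈ U
    · rw [Set.indicator_of_mem hz, Real.norm_eq_abs]
      refine (Finset.abs_sum_le_sum_abs _ _).trans (Finset.sum_le_sum fun j _ => ?_)
      rw [abs_mul, abs_of_nonneg (le_max_right (1 - _) (0 : ℝ))]
      refine mul_le_of_le_one_right (abs_nonneg _) (max_le ?_ zero_le_one)
      have : 0 ≤ K * ∑ a, |z a - x j a| :=
        mul_nonneg hK0.le (Finset.sum_nonneg fun _ _ => abs_nonneg _)
      linarith
    · rw [Set.indicator_of_notMem hz, Finset.sum_eq_zero, norm_zero]
      intro j _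
      rw [max_eq_right, mul_zero]
      by_contra! hlt
      refine hz (Metric.mem_cthickening_of_dist_le z (x j) _ _ ⟨j, rfl⟩ ?_)
      have hs : ∑ a, |z a - x j a| ≤ K⁻¹ := by
        rw [← one_div, le_div_iff₀' hK0]; linarith
      -- The sup distance is at most the `ℓ¹` distance.
      refine le_trans ((dist_pi_le_iff (Finset.sum_nonneg fun _ _ => abs_nonneg _)).2
        fun a => ?_) hs
      rw [Real.dist_eq]
      exact Finset.single_le_sum (f := fun a => |z a - x j a|) (fun _ _ => abs_nonneg _)
        (Finset.mem_univ a)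

/-! ### Assembly and parameter count -/

open NetEntries in
/-- The sum of a net and of finitely many bumps is a deeper net. -/
theorem exists_deepNet_add_bumps {d L n : ℕ} (hd : 0 < d) (g : DeepNet d L n) {m : ℕ}
    (x : Fin m → Fin d → ℝ) {K : ℝ} (hK : 0 ≤ K) (c : Fin m → ℝ) {D : ℕ} (hD : L + 1 ≤ D)
    (hD2 : 2 ≤ D) :
    ∃ N ≤ 2 * n + 2 * (D - L) + m * (6 * d + D), ∃ f : DeepNet d D N,
      (∀ z, f.eval z = g.eval z + ∑ j, c j * max (1 - K * ∑ a, |z a - x j a|) 0) ∧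
      (g.Unshared → f.Unshared) := by
  classical
  -- Tents need two layers and are carried through `k` more; `g` is deepened by `k' + 1 = D - L`
  -- layers.
  obtain ⟨k, rfl⟩ := Nat.exists_eq_add_of_le' hD2
  obtain ⟨k', hk'⟩ : ∃ k', k + 2 = k' + 1 + L := ⟨k + 2 - L - 1, by omega⟩
  let v : Fin n × Bool → ℝ := fun q => bif q.2 then g.param q.1 else -g.param q.1
  obtain ⟨G, hGe, hGc, hGu⟩ : ∃ G : NetEntries (Option (Fin n × Bool ⊕ ℝ)) d (k + 1 + 1),
      (∀ z, G.evalWith (Sum.elim v id) z = g.eval z) ∧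
      G.labels.countP (·.isRight) = 2 * (k' + 1) ∧
      ∀ q, G.labels.count (.inl q) ≤ g.pattern.labels.count q.1 := by
    rw [show k + 1 + 1 = k' + 1 + L from hk']
    exact ⟨g.pattern.extend k', evalWith_extend _ _ _, countP_labels_extend _ _,
      count_labels_extend _ _⟩
  obtain ⟨M, hMe, hMl⟩ := exists_add_sum (Sum.elim v id) G
    (fun j => bump hd K (c j) (x j) k) Finset.univ
  obtain ⟨N, hN, f, hf, hfu⟩ := exists_deepNet v M
  refine ⟨N, hN.trans ?_, f, fun z => ?_, fun hg => hfu fun q => ?_⟩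
  · rw [hMl, Multiset.countP_add, hGc, countP_sum]
    have : ∑ j, (bump (κ := Fin n × Bool) hd K (c j) (x j) k).labels.countP (·.isRight) ≤
        ∑ _j : Fin m, (6 * d + (k + 2)) :=
      Finset.sum_le_sum fun j _ => (Multiset.countP_le_card _ _).trans
        (labels_bump hd K (c j) (x j) k).1.le
    rw [Finset.sum_const, Finset.card_univ, Fintype.card_fin, smul_eq_mul] at this
    rw [Fintype.card_prod, Fintype.card_fin, Fintype.card_bool]
    have : k' + 1 = k + 2 - L := by omega
    rw [this]
    omega
  · rw [hf, hMe, hGe]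
    simp only [evalWith_bump _ hd hK]
  · rw [hMl, Multiset.count_add, Multiset.count_sum', Finset.sum_eq_zero, add_zero]
    · exact (hGu q).trans ((count_labels _ _).trans_le (hg q.1))
    · exact fun j _ => Multiset.count_eq_zero_of_notMem ((labels_bump hd K (c j) (x j) k).2 q)

theorem theorem5 (d : ℕ) (hd : 0 < d) :
    ∃ C : ℝ, 0 < C ∧
      ∀ (θ : ℝ) (Lt : ℕ), 0 < θ → θ ≤ 1 → (2 * θ)⁻¹ < (Lt : ℝ) →
      ∀ (L n : ℕ), 1 ≤ L →
      ∀ (g : DeepNet d L n) (Cstar : ℝ), 0 < Cstar →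
        eLpNorm g.eval ∞ (volume.restrict (cube d)) ≤ ENNReal.ofReal Cstar →
      ∀ (X : Set (Fin d → ℝ)), MeasurableSet X → X ⊆ cube d →
      ∀ (ρ : Measure (Fin d → ℝ)), IsProbabilityMeasure ρ → ρ Xᶜ = 0 →
      ∀ (p : ℝ), 2 ≤ p → distortion X ρ p < ∞ →
      ∀ (m : ℕ), 1 ≤ m →
      ∀ (x : Fin m → Fin d → ℝ) (y : Fin m → ℝ), (∀ i j, x i = x j → y i = y j) →
      ∀ (ε : ℝ), 0 < ε →
      ∃ N : ℕ, (N : ℝ) ≤ C * ((n : ℝ) + (m : ℝ) * ((Lt : ℝ) + (L : ℝ)) + ε ^ (-θ)) ∧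
        ∃ f : DeepNet d (4 * Lt + 16 + max L 2) N,
          (g.Unshared → f.Unshared) ∧
          (∀ i, f.eval (x i) = y i) ∧
          eLpNorm (fun z => f.eval z - g.eval z) 2 ρ ≤ ENNReal.ofReal ε := by
  -- `60 = 2 * 19 + 22`, from the bounds `h3` and `h2` below, which use `max L 2 ≤ L + 1`.
  refine ⟨6 * d + 60, by positivity, ?_⟩
  intro θ Lt _ _ _ L n hL g Cstar _ _ X _ _ ρ _ _ p _ hdist m hm x y hxy ε hε
  have : Nonempty (Fin d) := ⟨⟨0, hd⟩⟩
  have hρ : ρ (Set.range x) = 0 :=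
    measure_eq_zero_of_distortion_lt_top hdist (Set.finite_range x).measurableSet
      ((Set.finite_range x).measure_zero _)
  obtain ⟨K, c, hK, hint, hnorm⟩ := exists_bump_interpolation x hρ
    (fun i => y i - g.eval (x i)) (fun i j h => by simp only [hxy i j h, h]) hε
  obtain ⟨N, hN, f, hf, hfu⟩ := exists_deepNet_add_bumps hd g x hK.le c
    (D := 4 * Lt + 16 + max L 2) (by omega) (by omega)
  refine ⟨N, ?_, f, hfu, fun i => ?_, ?_⟩
  · have h1 : N ≤ (6 * d + 60) * (n + m * (Lt + L)) := by
      have h2 : 4 * Lt + 16 + max L 2 ≤ 22 * (Lt + L) := by omega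
      have h3 : 4 * Lt + 16 + max L 2 - L ≤ m * (19 * (Lt + L)) :=
        le_trans (by omega) (Nat.le_mul_of_pos_left _ hm)
      have h4 : m * (6 * d + (4 * Lt + 16 + max L 2)) ≤
          m * (6 * d * (Lt + L) + 22 * (Lt + L)) :=
        Nat.mul_le_mul_left _ (add_le_add (Nat.le_mul_of_pos_right _ (by omega)) h2)
      calc N ≤ 2 * n + 2 * (m * (19 * (Lt + L))) + m * (6 * d * (Lt + L) + 22 * (Lt + L)) := by
            omega
        _ = 2 * n + (6 * d + 60) * (m * (Lt + L)) := by ring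
        _ ≤ (6 * d + 60) * n + (6 * d + 60) * (m * (Lt + L)) := by gcongr; omega
        _ = _ := by ring
    calc (N : ℝ) ≤ (6 * d + 60) * (n + m * (Lt + L)) := by exact_mod_cast h1
      _ ≤ _ := by
        exact mul_le_mul_of_nonneg_left (le_add_of_nonneg_right (Real.rpow_nonneg hε.le _))
          (by positivity)
  · rw [hf, hint]; ring
  · simpa only [hf, add_sub_cancel_left] using hnorm
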